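/- Let $F$ be a field of characteristic $0$ and let $n\ge 1$ be an integer. Let $T_n$ be the algebra of all polynomials $p\in F[x_1,\dots,x_n]$ that are symmetric (invariant under all permutations of $x_1,\dots,x_n$) and such that the polynomial in $F[t,x_3,\dots,x_n]$ obtained from $p$ by the substitution $x_1=t$, $x_2=-t$ is independent of $t$ (this second condition is empty if $n=1$). For $k\ge 0$ let $p_{2k+1}=x_1^{2k+1}+\dots+x_n^{2k+1}$, and put $i(n)=\lfloor n/2\rfloor$ and $j(n)=\lfloor (n-1)/2\rfloor$. For a finite multiset $s$ of non-negative integers, the product of odd power sums $p_s=\prod_{m\in s}p_{2m+1}$ (with $p_\emptyset=1$) is called proper if at most $i(n)$ elements $m$ of $s$, counted with multiplicity, satisfy $m>j(n)$. Then $T_n$ is generated as an $F$-algebra by the odd power sums $p_{2k+1}$, $k\ge 0$. Moreover, the family of proper products $p_s$, indexed by the multisets $s$ for which $p_s$ is proper, is a basis of $T_n$ as an $F$-vector space. -/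

import Mathlib

namespace MonoSusy

/-- The substitution `x_1 = t`, `x_2 = -t` (the other variables are kept): the result is a polynomial
in `t` with coefficients in `F[x_1, …, x_n]`. The variable `x_{k+1}` is `X k`, for `k : Fin n`. -/
noncomputable def subst (F : Type*) [Field F] (n : ℕ) :
    MvPolynomial (Fin n) F →ₐ[F] Polynomial (MvPolynomial (Fin n) F) :=
  MvPolynomial.aeval fun k : Fin n =>
    if k.val = 0 then Polynomial.X
    else if k.val = 1 then -Polynomial.X
    else Polynomial.C (MvPolynomial.X k)

/-- Monotypically supersymmetric polynomials: symmetric, and independent of `t` after the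
substitution `x_1 = t`, `x_2 = -t`. For fewer than two variables there is no pair of variables to
substitute for, and the second condition is empty. -/
def IsMonoSusy {F : Type*} [Field F] {n : ℕ} (p : MvPolynomial (Fin n) F) : Prop :=
  p.IsSymmetric ∧
    (2 ≤ n → ∃ c : MvPolynomial (Fin n) F, subst F n p = Polynomial.C c)

/-- The algebra `T_n` of monotypically supersymmetric polynomials in `n` variables. -/
noncomputable def T (F : Type*) [Field F] (n : ℕ) : Subalgebra F (MvPolynomial (Fin n) F) where
  carrier := {p | IsMonoSusy p}
  mul_mem' := by
    rintro p q ⟨hp, hp'⟩ ⟨hq, hq'⟩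
    refine ⟨hp.mul hq, fun h => ?_⟩
    obtain ⟨c, hc⟩ := hp' h
    obtain ⟨d, hd⟩ := hq' h
    exact ⟨c * d, by rw [map_mul, hc, hd, Polynomial.C_mul]⟩
  add_mem' := by
    rintro p q ⟨hp, hp'⟩ ⟨hq, hq'⟩
    refine ⟨hp.add hq, fun h => ?_⟩
    obtain ⟨c, hc⟩ := hp' h
    obtain ⟨d, hd⟩ := hq' h
    exact ⟨c + d, by rw [map_add, hc, hd, Polynomial.C_add]⟩
  algebraMap_mem' := fun r =>
    ⟨MvPolynomial.IsSymmetric.C r, fun _ => ⟨MvPolynomial.C r, (subst F n).commutes r⟩⟩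

/-- The product `∏ p_{2m+1}` of odd power sums, `m` running over the multiset `s`. -/
noncomputable def oddProd (F : Type*) [Field F] (n : ℕ) (s : Multiset ℕ) :
    MvPolynomial (Fin n) F :=
  (s.map fun m => MvPolynomial.psum (Fin n) F (2 * m + 1)).prod

/-- `i(n)`: the largest integer with `2 i(n) ≤ n`. -/
def iIdx (n : ℕ) : ℕ := n / 2

/-- `j(n)`: the largest integer with `2 j(n) + 1 ≤ n`, for positive `n`. -/
def jIdx (n : ℕ) : ℕ := (n - 1) / 2

/-- The product of the `p_{2m+1}`, `m ∈ s`, is proper: at most `i(n)` of its factors, counted with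
multiplicity, have `m > j(n)`. -/
def IsProper (n : ℕ) (s : Multiset ℕ) : Prop :=
  (s.filter fun m => jIdx n < m).card ≤ iIdx n

end MonoSusy

/-!
The proof compares an upper bound for the dimension of the space of elements of `T_n` of degree at
most `D` with the number of proper products of degree at most `D`, and shows that these products are
linearly independent; so they form a basis, and in particular they span.

*Upper bound.* Let `p ∈ T_n` and let `x ^ m` be a monomial of `p` for which `∑ m_k ^ 2` is maximal.
If `m_k = m_l = r > 0` for some `k ≠ l`, the substitution `x_k = t`, `x_l = -t` would leave a
nonzero term in `t ^ (2 r)`, since all monomials that could cancel it have a larger sum of squares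
(`apply_ne_of_isMonoSusy`). Hence `p` is determined by its coefficients at strict partitions with at
most `n` parts. A Sylvester-type bijection (`oddOfStrict`) maps these injectively, and compatibly
with degrees, to the multisets indexing proper products.

*Independence.* Write `n = 2 i + e` with `e ≤ 1`, and `j = j(n)`. Substitute for the variables
`y_b + θ ^ 2 u_b` and `-y_b` for `b < i`, and in the odd case also a multiple of `θ ^ 2`. The
coefficient of `θ ^ 2` in `p_{2m+1}` is `(2 m + 1) ∑ u_b y_b ^ (2 m)`, up to a correction for
`m = 0`. By Lagrange interpolation the `u_b` can be chosen over `F(y)[c_0, …, c_j][θ]` such that the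
small power sums (`m ≤ j`) have the independent variables `c_m` as lowest coefficients, with those
for `m < j` of higher order in `θ`. Then the large ones have the lowest coefficient
`const * c_j * h_{m-j}(y_1 ^ 2, …, y_i ^ 2)`, with `h` the complete homogeneous symmetric
polynomials (`exists_degeneration`). So everything reduces to the independence of products of at
most `i` of the `h_k` in `i` variables (`linearIndependent_prod_remCoeff`). This follows from the
Jacobi–Trudi identity: the Schur polynomials are quotients of alternants, hence independent, they
lie in the span of these products, and there are as many of them.
-/

namespace MonoSusy

/-! ### A Sylvester-type bijection -/

/-- The alternating sum `a₀ - a₁ + a₂ - ⋯` of a list. On strictly decreasing lists of positive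
integers, the only ones on which it is used, the subtractions are not truncated. -/
def altSum : List ℕ → ℕ
  | [] => 0
  | x :: l => x - altSum l

/-- The multiset `s` attached to a strict partition `l` by a Sylvester-type bijection between strict
partitions and partitions into odd parts, the odd part `2 m + 1` being recorded as `m`. -/
def oddOfStrict : List ℕ → Multiset ℕ
  | [] => 0
  | [x] => Multiset.replicate x 0
  | x :: y :: l =>
    altSum (y :: l) ::ₘ ((oddOfStrict l).map Nat.succ + Multiset.replicate (x - y - 1) 0)

/-- Strict partitions, as strictly decreasing lists of positive integers. -/
def IsStrict (l : List ℕ) : Prop :=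
  l.Pairwise (· > ·) ∧ ∀ x ∈ l, 0 < x

theorem IsStrict.tail {x : ℕ} {l : List ℕ} (h : IsStrict (x :: l)) : IsStrict l :=
  ⟨(List.pairwise_cons.1 h.1).2, fun y hy => h.2 y (List.mem_cons_of_mem _ hy)⟩

theorem IsStrict.altSum_lt {x : ℕ} {l : List ℕ} (h : IsStrict (x :: l)) : altSum l < x := by
  cases l with
  | nil => exact h.2 x (by simp)
  | cons y l =>
    have : y < x := (List.pairwise_cons.1 h.1).1 y (by simp)
    simp only [altSum]
    omega

theorem card_oddOfStrict : ∀ {l : List ℕ}, IsStrict l → (oddOfStrict l).card = altSum l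
  | [], _ => by simp [oddOfStrict, altSum]
  | [x], _ => by simp [oddOfStrict, altSum]
  | x :: y :: l, h => by
    have h1 := h.tail.altSum_lt
    have h2 := h.altSum_lt
    have h3 : y < x := (List.pairwise_cons.1 h.1).1 y (by simp)
    simp only [oddOfStrict, altSum, Multiset.card_cons, Multiset.card_add, Multiset.card_map,
      Multiset.card_replicate, card_oddOfStrict h.tail.tail] at h2 ⊢
    omega

/-- The degree of the product of odd power sums indexed by `s`. -/
def oddWeight (s : Multiset ℕ) : ℕ := (s.map fun m => 2 * m + 1).sum

theorem oddWeight_oddOfStrict : ∀ {l : List ℕ}, IsStrict l → oddWeight (oddOfStrict l) = l.sum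
  | [], _ => by simp [oddOfStrict, oddWeight]
  | [x], _ => by simp [oddOfStrict, oddWeight]
  | x :: y :: l, h => by
    have h1 := h.tail.altSum_lt
    have h3 : y < x := (List.pairwise_cons.1 h.1).1 y (by simp)
    have ih := oddWeight_oddOfStrict h.tail.tail
    have hc := card_oddOfStrict h.tail.tail
    have key : ((oddOfStrict l).map fun m => 2 * (m + 1) + 1).sum = l.sum + 2 * altSum l := by
      rw [← ih, ← hc, oddWeight]
      have : (fun m : ℕ => 2 * (m + 1) + 1) = fun m => (2 * m + 1) + 2 := by ext; ring
      rw [this, Multiset.sum_map_add]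
      simp [mul_comm]
    simp only [oddWeight, oddOfStrict, Multiset.map_cons, Multiset.map_add, Multiset.map_map,
      Function.comp_def, Multiset.map_replicate, Multiset.sum_cons, Multiset.sum_add,
      Multiset.sum_replicate, List.sum_cons, Nat.succ_eq_add_one, key, altSum, smul_eq_mul]
    omega

theorem le_altSum_of_mem_oddOfStrict : ∀ {x : ℕ} {l : List ℕ}, IsStrict (x :: l) →
    ∀ m ∈ oddOfStrict (x :: l), m ≤ altSum l
  | x, [], _ => by
    intro m hm
    simp [oddOfStrict, Multiset.mem_replicate] at hm
    simp [hm.2]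
  | x, [y], h => by
    intro m hm
    simp [oddOfStrict, Multiset.mem_replicate] at hm
    omega
  | x, y :: z :: l, h => by
    intro m hm
    have h1 := h.tail.tail.altSum_lt
    have h3 : z < y := (List.pairwise_cons.1 h.tail.1).1 z (by simp)
    simp only [oddOfStrict, Multiset.mem_cons, Multiset.mem_add, Multiset.mem_map,
      Multiset.mem_replicate] at hm
    rcases hm with rfl | ⟨k, hk, rfl⟩ | ⟨-, rfl⟩
    · exact le_rfl
    · have := le_altSum_of_mem_oddOfStrict h.tail.tail k hk
      simp only [altSum]
      omega
    · exact Nat.zero_le _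

/-- The largest element of the multiset is the alternating sum of the tail of the strict partition,
so the multiset determines this number, then (from the multiplicity of `0`) the difference of the
first two parts, and, recursively, the remaining parts. -/
theorem oddOfStrict_injective : ∀ {l l' : List ℕ}, IsStrict l → IsStrict l' →
    oddOfStrict l = oddOfStrict l' → l = l'
  | [], [], _, _, _ => rfl
  | [], [x], _, h', e => by
    have := congrArg Multiset.card e
    have := h'.2 x (by simp)
    simp [oddOfStrict] at *
    omega
  | [x], [], h, _, e => by
    have := congrArg Multiset.card e
    have := h.2 x (by simp)
    simp [oddOfStrict] at *
    omega
  | [x], [y], _, _, e => by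
    have := congrArg Multiset.card e
    simpa [oddOfStrict] using this
  | [], x :: y :: l, _, _, e => by simp [oddOfStrict] at e
  | x :: y :: l, [], _, _, e => by simp [oddOfStrict] at e
  | [z], x :: y :: l, _, h', e => by
    have h1 := h'.tail.altSum_lt
    have : altSum (y :: l) ∈ oddOfStrict [z] := by rw [e]; simp [oddOfStrict]
    simp only [oddOfStrict, Multiset.mem_replicate, altSum] at this
    omega
  | x :: y :: l, [z], h, _, e => by
    have h1 := h.tail.altSum_lt
    have : altSum (y :: l) ∈ oddOfStrict [z] := by rw [← e]; simp [oddOfStrict]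
    simp only [oddOfStrict, Multiset.mem_replicate, altSum] at this
    omega
  | x :: y :: l, x' :: y' :: l', h, h', e => by
    have a1 : altSum (y :: l) ≤ altSum (y' :: l') := by
      apply le_altSum_of_mem_oddOfStrict h'
      rw [← e]; simp [oddOfStrict]
    have a2 : altSum (y' :: l') ≤ altSum (y :: l) := by
      apply le_altSum_of_mem_oddOfStrict h
      rw [e]; simp [oddOfStrict]
    have a3 := le_antisymm a1 a2
    simp only [oddOfStrict] at e
    rw [a3, Multiset.cons_inj_right] at e
    have c0 := congrArg (Multiset.count 0) e
    have f0 := congrArg (Multiset.filter (0 < ·)) e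
    have hs : ∀ s : Multiset ℕ, Multiset.count 0 (s.map Nat.succ) = 0 := by
      intro s; simp
    have hf : ∀ s : Multiset ℕ, Multiset.filter (0 < ·) (s.map Nat.succ) = s.map Nat.succ := by
      intro s; simp [Multiset.filter_eq_self]
    have hr : ∀ k : ℕ, Multiset.filter (0 < ·) (Multiset.replicate k 0) = 0 := by
      intro k; simp [Multiset.filter_eq_nil, Multiset.mem_replicate]
    rw [Multiset.count_add, Multiset.count_add, hs, hs, Multiset.count_replicate_self,
      Multiset.count_replicate_self] at c0
    rw [Multiset.filter_add, Multiset.filter_add, hf, hf, hr, hr, add_zero, add_zero] at f0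
    have hl := oddOfStrict_injective h.tail.tail h'.tail.tail
      (Multiset.map_injective Nat.succ_injective f0)
    subst hl
    have h1 := h.tail.altSum_lt
    have h1' := h'.tail.altSum_lt
    have h3 : y < x := (List.pairwise_cons.1 h.1).1 y (by simp)
    have h3' : y' < x' := (List.pairwise_cons.1 h'.1).1 y' (by simp)
    simp only [altSum] at a3
    obtain rfl : y = y' := by omega
    obtain rfl : x = x' := by omega
    rfl

/-- For `0 < n`, this says that strict partitions with at most `n` parts index proper products. -/
theorem card_filter_oddOfStrict_le : ∀ {l : List ℕ} {n : ℕ}, l.length ≤ n →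
    ((oddOfStrict l).filter fun m => (n + 1) / 2 ≤ m).card ≤ n / 2
  | [], n, _ => by simp [oddOfStrict]
  | [x], n, h => by
    have : (n + 1) / 2 ≠ 0 := by simp at h; omega
    rw [oddOfStrict, Multiset.filter_eq_nil.2]
    · simp
    · intro m hm
      rw [(Multiset.mem_replicate.1 hm).2]
      omega
  | x :: y :: l, n, h => by
    obtain ⟨k, rfl⟩ : ∃ k, n = k + 2 := ⟨n - 2, by simp at h; omega⟩
    have ih := card_filter_oddOfStrict_le (l := l) (n := k) (by simpa using h)
    have e : (k + 2 + 1) / 2 = (k + 1) / 2 + 1 := by omega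
    have e' : (k + 2) / 2 = k / 2 + 1 := by omega
    have hr : ∀ q : ℕ, Multiset.filter (fun m => (k + 1) / 2 + 1 ≤ m)
        (Multiset.replicate q 0) = 0 := by
      intro q
      rw [Multiset.filter_eq_nil]
      intro m hm
      rw [(Multiset.mem_replicate.1 hm).2]
      omega
    rw [oddOfStrict, e, e', ← Multiset.singleton_add, Multiset.filter_add, Multiset.filter_add, hr,
      Multiset.filter_map, add_zero, Multiset.card_add, Multiset.card_map, add_comm]
    refine add_le_add ?_ ((Multiset.card_le_card (Multiset.filter_le _ _)).trans (by simp))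
    simpa [Function.comp_def] using ih

theorem finite_oddWeight_le (D : ℕ) : {s : Multiset ℕ | oddWeight s ≤ D}.Finite := by
  refine (Set.finite_Iic (∑ m ∈ Finset.range (D + 1), Multiset.replicate D m)).subset ?_
  intro s hs
  have hs' : (s.map fun m => 2 * m + 1).sum ≤ D := hs
  have hcard : s.card ≤ D := by
    refine le_trans ?_ hs'
    simpa only [Multiset.map_const', Multiset.sum_replicate, smul_eq_mul, mul_one] using
      Multiset.sum_map_le_sum_map (fun _ => 1) (fun m => 2 * m + 1) (s := s)
      fun m _ => Nat.le_add_left 1 (2 * m)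
  rw [Set.mem_Iic, Multiset.le_iff_count]
  intro m
  by_cases hm : m ∈ s
  · have hle : 2 * m + 1 ≤ D :=
      (Multiset.le_sum_of_mem (Multiset.mem_map_of_mem (fun m => 2 * m + 1) hm)).trans hs'
    rw [Multiset.count_sum']
    calc s.count m ≤ D := (Multiset.count_le_card _ _).trans hcard
      _ = (Multiset.replicate D m).count m := by simp
      _ ≤ _ := Finset.single_le_sum (f := fun k => (Multiset.replicate D k).count m)
        (fun _ _ => Nat.zero_le _) (Finset.mem_range.2 (by omega))
  · simp [Multiset.count_eq_zero_of_notMem hm]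

/-! ### Leading monomials of monotypically supersymmetric polynomials -/

theorem subst_monomial {F : Type*} [Field F] {k : ℕ} (d : Fin (k + 2) →₀ ℕ) (a : F) :
    subst F (k + 2) (MvPolynomial.monomial d a) =
      Polynomial.monomial (d 0 + d 1)
        (MvPolynomial.monomial ((d.erase 0).erase 1) (a * (-1) ^ d 1)) := by
  have h1 : (Finsupp.erase 1 (Finsupp.erase 0 d)) 0 = 0 := by
    rw [Finsupp.erase_ne (by simp), Finsupp.erase_same]
  have h2 : (Finsupp.erase 1 (Finsupp.erase 0 d)) 1 = 0 := Finsupp.erase_same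
  have h3 : ∀ i : Fin k, (Finsupp.erase 1 (Finsupp.erase 0 d)) i.succ.succ = d i.succ.succ := by
    intro i
    rw [Finsupp.erase_ne (by simp [Fin.ext_iff]), Finsupp.erase_ne (by simp [Fin.ext_iff])]
  rw [subst, MvPolynomial.aeval_monomial, Finsupp.prod_fintype _ _ (by simp),
    ← Polynomial.C_mul_X_pow_eq_monomial, MvPolynomial.monomial_eq,
    Finsupp.prod_fintype _ _ (by simp), Fin.prod_univ_succ, Fin.prod_univ_succ, Fin.prod_univ_succ,
    Fin.prod_univ_succ]
  have h4 : (Fin.succ 0 : Fin (k + 2)) = 1 := rfl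
  rw [h4, h1, h2]
  simp only [h3]
  have h5 : (algebraMap F (Polynomial (MvPolynomial (Fin (k + 2)) F))) a
      = Polynomial.C (MvPolynomial.C a) := rfl
  simp [h5, map_prod]
  rw [neg_pow (Polynomial.X : Polynomial (MvPolynomial (Fin (k + 2)) F)) (d 1)]
  ring

/-- Coefficients of the substitution: the exponents of the first two variables are added, with a
sign from the second one. -/
theorem coeff_coeff_subst {F : Type*} [Field F] {k : ℕ} (p : MvPolynomial (Fin (k + 2)) F) (N : ℕ)
    (μ : Fin (k + 2) →₀ ℕ) :
    ((subst F (k + 2) p).coeff N).coeff μ =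
      ∑ d ∈ p.support, if d 0 + d 1 = N ∧ (d.erase 0).erase 1 = μ then p.coeff d * (-1) ^ d 1
        else 0 := by
  conv_lhs => rw [p.as_sum]
  rw [map_sum, Polynomial.finsetSum_coeff, MvPolynomial.coeff_sum]
  refine Finset.sum_congr rfl fun d _ => ?_
  rw [subst_monomial, Polynomial.coeff_monomial]
  by_cases h : d 0 + d 1 = N
  · simp [h, MvPolynomial.coeff_monomial]
  · simp [h]

theorem coeff_equivMapDomain_of_isSymmetric {σ R : Type*} [CommSemiring R]
    {p : MvPolynomial σ R} (hp : p.IsSymmetric) (e : Equiv.Perm σ) (d : σ →₀ ℕ) :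
    p.coeff (d.equivMapDomain e) = p.coeff d := by
  conv_lhs => rw [← hp e]
  rw [Finsupp.equivMapDomain_eq_mapDomain, MvPolynomial.coeff_rename_mapDomain _ e.injective]

/-- For a symmetric `p`, the exponents in the support of `p` with the largest sum of squares cannot
have two equal positive entries: such entries `r, r` would contribute a term `± c t ^ (2 r)` to the
substitution, and cancelling it would require an exponent with entries `r + q, r - q` instead, whose
sum of squares is larger. -/
theorem apply_ne_of_isMonoSusy {F : Type*} [Field F] {n : ℕ} {p : MvPolynomial (Fin n) F}
    (hp : IsMonoSusy p) {m : Fin n →₀ ℕ} (hm : m ∈ p.support)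
    (hmax : ∀ d ∈ p.support, ∑ i, d i ^ 2 ≤ ∑ i, m i ^ 2) {a b : Fin n} (hab : a ≠ b)
    (ha : 0 < m a) : m a ≠ m b := by
  intro he
  obtain ⟨k, rfl⟩ : ∃ k, n = k + 2 := by
    refine ⟨n - 2, ?_⟩
    have := a.2; have := b.2
    have : a.1 ≠ b.1 := fun h => hab (Fin.ext h)
    omega
  obtain ⟨e, e0, e1⟩ : ∃ e : Equiv.Perm (Fin (k + 2)), e 0 = a ∧ e 1 = b := by
    have hc : Equiv.swap 0 a (1 : Fin (k + 2)) ≠ a := by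
      intro h
      have := (Equiv.swap 0 a).injective (h.trans (Equiv.swap_apply_left 0 a).symm)
      simp at this
    refine ⟨Equiv.swap (Equiv.swap 0 a 1) b * Equiv.swap 0 a, ?_, ?_⟩
    · rw [Equiv.Perm.mul_apply, Equiv.swap_apply_left, Equiv.swap_apply_of_ne_of_ne hc.symm hab]
    · rw [Equiv.Perm.mul_apply, Equiv.swap_apply_left]
  -- move the two equal entries to the positions `0` and `1`
  set u := m.equivMapDomain e.symm with hu
  have u0 : u 0 = m a := by simp [hu, Finsupp.equivMapDomain_apply, e0]
  have u1 : u 1 = m a := by simp [hu, Finsupp.equivMapDomain_apply, e1, he]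
  have husum : ∑ i, u i ^ 2 = ∑ i, m i ^ 2 := by
    simp only [hu, Finsupp.equivMapDomain_apply, Equiv.symm_symm]
    exact Equiv.sum_comp e fun i => m i ^ 2
  have hus : p.coeff u ≠ 0 := by
    rw [hu, coeff_equivMapDomain_of_isSymmetric hp.1]
    exact MvPolynomial.mem_support_iff.1 hm
  obtain ⟨c, hc⟩ := hp.2 (by omega)
  have key := coeff_coeff_subst p (2 * m a) ((u.erase 0).erase 1)
  rw [hc, Polynomial.coeff_C_of_ne_zero (by omega), MvPolynomial.coeff_zero,
    Finset.sum_eq_single u] at key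
  · rw [if_pos ⟨by omega, rfl⟩] at key
    exact mul_ne_zero hus (pow_ne_zero _ (by simp)) key.symm
  · intro d hd hdu
    rw [if_neg]
    rintro ⟨hN, hE⟩
    refine hdu ?_
    have hrest : ∀ i : Fin k, d i.succ.succ = u i.succ.succ := by
      intro i
      have := DFunLike.congr_fun hE i.succ.succ
      rwa [Finsupp.erase_ne (by simp [Fin.ext_iff]), Finsupp.erase_ne (by simp [Fin.ext_iff]),
        Finsupp.erase_ne (by simp [Fin.ext_iff]), Finsupp.erase_ne (by simp [Fin.ext_iff])] at this
    have hle := hmax d hd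
    rw [← husum, Fin.sum_univ_succ, Fin.sum_univ_succ, Fin.sum_univ_succ, Fin.sum_univ_succ] at hle
    have h4 : (Fin.succ 0 : Fin (k + 2)) = 1 := rfl
    simp only [hrest, h4, u0, u1] at hle
    have hle' : d 0 ^ 2 + d 1 ^ 2 ≤ m a ^ 2 + m a ^ 2 := by omega
    have h0 : d 0 = m a := by
      zify at hN hle' ⊢
      have : ((d 0 : ℤ) - m a) ^ 2 ≤ 0 := by
        have h1 : (d 1 : ℤ) = 2 * m a - d 0 := by omega
        rw [h1] at hle'
        nlinarith
      nlinarith [sq_eq_zero_iff.1 (le_antisymm this (sq_nonneg _))]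
    have h1 : d 1 = m a := by omega
    ext i
    refine Fin.cases (by rw [h0, u0]) (fun i => ?_) i
    refine Fin.cases (by rw [h4, h1, u1]) (fun i => hrest i) i
  · intro h
    exact absurd (MvPolynomial.mem_support_iff.2 hus) h

/-- The exponent of the monomial `∏ x_i ^ l_i`, the list `l` being continued by zeros. -/
noncomputable def listExponent (n : ℕ) (l : List ℕ) : Fin n →₀ ℕ :=
  Finsupp.equivFunOnFinite.symm fun i => l.getD i 0

theorem map_listExponent {n : ℕ} {l : List ℕ} (h : l.length ≤ n) :
    Finset.univ.val.map (listExponent n l) = (l : Multiset ℕ) + Multiset.replicate (n - l.length) 0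
    := by
  have : List.ofFn (fun i : Fin n => l.getD i 0) = l ++ List.replicate (n - l.length) 0 := by
    apply List.ext_getElem
    · simp; omega
    · intro i h1 h2
      rw [List.getElem_ofFn]
      by_cases hi : i < l.length
      · rw [List.getElem_append_left hi]
        simp [hi]
      · rw [List.getElem_append_right (by omega)]
        simp [List.getElem?_eq_none (not_lt.1 hi)]
  rw [← Multiset.coe_replicate, Multiset.coe_add, ← this, ← Fin.univ_val_map]
  rfl

theorem exists_perm_of_map_univ_eq {α β : Type*} [Fintype α] {f g : α → β}
    (h : Finset.univ.val.map f = Finset.univ.val.map g) :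
    ∃ e : Equiv.Perm α, ∀ a, f a = g (e a) := by
  classical
  refine ⟨Equiv.ofFiberEquiv fun c => Fintype.equivOfCardEq ?_,
    fun a => (Equiv.ofFiberEquiv_map _ a).symm⟩
  have := congrArg (Multiset.count c) h
  rw [Multiset.count_map, Multiset.count_map] at this
  rw [Fintype.card_subtype, Fintype.card_subtype, Finset.card, Finset.card, Finset.filter_val,
    Finset.filter_val]
  simpa only [eq_comm] using this

/-- By symmetry, the distinct positive exponents found in `apply_ne_of_isMonoSusy` may be put in
decreasing order, so some coefficient at a strict partition does not vanish. -/
theorem exists_strict_coeff_ne_zero {F : Type*} [Field F] {n : ℕ} {p : MvPolynomial (Fin n) F}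
    (hp : IsMonoSusy p) (h0 : p ≠ 0) :
    ∃ l, IsStrict l ∧ l.length ≤ n ∧ p.coeff (listExponent n l) ≠ 0 := by
  obtain ⟨m, hm, hmax⟩ := p.support.exists_max_image (fun d => ∑ i, d i ^ 2)
    (MvPolynomial.support_nonempty.2 h0)
  set V : Multiset ℕ := Finset.univ.val.map m with hV
  set l := (V.filter (0 < ·)).sort (· ≥ ·) with hl
  have hlV : (l : Multiset ℕ) = V.filter (0 < ·) := Multiset.sort_eq _ _
  have hlen : l.length = (V.filter (0 < ·)).card := by simp [hl]
  have hVc : V.card = n := by simp [hV]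
  have hlen' : l.length ≤ n := by
    rw [hlen, ← hVc]; exact Multiset.card_le_card (Multiset.filter_le _ _)
  have hnodup : l.Nodup := by
    rw [← Multiset.coe_nodup, hlV, hV, Multiset.filter_map]
    refine Multiset.Nodup.map_on ?_ (Finset.univ.nodup.filter _)
    intro a ha b _ hab
    by_contra hne
    exact apply_ne_of_isMonoSusy hp hm hmax hne (Multiset.mem_filter.1 ha).2 hab
  have hstrict : IsStrict l := by
    refine ⟨?_, fun x hx => ?_⟩
    · have h1 : l.Pairwise (· ≥ ·) := Multiset.pairwise_sort _ _
      exact (h1.and hnodup).imp fun h => lt_of_le_of_ne h.1 h.2.symm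
    · have : x ∈ (l : Multiset ℕ) := hx
      rw [hlV] at this
      exact (Multiset.mem_filter.1 this).2
  refine ⟨l, hstrict, hlen', ?_⟩
  have hmap : Finset.univ.val.map (listExponent n l) = V := by
    rw [map_listExponent hlen', hlV]
    conv_rhs => rw [← Multiset.filter_add_not (0 < ·) V]
    congr 1
    symm
    rw [Multiset.eq_replicate]
    constructor
    · have := congrArg Multiset.card (Multiset.filter_add_not (0 < ·) V)
      rw [Multiset.card_add, hVc] at this
      omega
    · intro b hb
      simpa using (Multiset.mem_filter.1 hb).2
  obtain ⟨e, he⟩ := exists_perm_of_map_univ_eq hmap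
  have : listExponent n l = m.equivMapDomain e.symm := by
    ext i
    rw [Finsupp.equivMapDomain_apply, Equiv.symm_symm, he]
  rw [this, coeff_equivMapDomain_of_isSymmetric hp.1]
  exact MvPolynomial.mem_support_iff.1 hm

/-- The elements of `T_n` of degree at most `D`. -/
noncomputable def TLE (F : Type*) [Field F] (n D : ℕ) : Submodule F (MvPolynomial (Fin n) F) :=
  (T F n).toSubmodule ⊓ MvPolynomial.restrictTotalDegree (Fin n) F D

/-- The multisets indexing the proper products of degree at most `D`. For `n > 0` the condition
`(n + 1) / 2 ≤ m` is equivalent to `jIdx n < m`; stated in this way, the bound also holds for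
`n = 0`. -/
def ProperLE (n D : ℕ) : Set (Multiset ℕ) :=
  {s | (s.filter fun m => (n + 1) / 2 ≤ m).card ≤ n / 2 ∧ oddWeight s ≤ D}

instance (n D : ℕ) : Finite (ProperLE n D) :=
  ((finite_oddWeight_le D).subset fun _ h => h.2).to_subtype

/-- The coefficients at strict partitions determine an element of `T_n`, and `oddOfStrict` injects
these partitions into the index set of the proper products. -/
theorem finiteDimensional_TLE_and_finrank_le (F : Type*) [Field F] (n D : ℕ) :
    FiniteDimensional F (TLE F n D) ∧ Module.finrank F (TLE F n D) ≤ Nat.card (ProperLE n D) := by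
  let S := {l : List ℕ // IsStrict l ∧ l.length ≤ n ∧ l.sum ≤ D}
  let φ : S → ProperLE n D := fun l => ⟨oddOfStrict l.1,
    card_filter_oddOfStrict_le l.2.2.1, (oddWeight_oddOfStrict l.2.1).trans_le l.2.2.2⟩
  have hφ : Function.Injective φ := fun l l' h =>
    Subtype.ext (oddOfStrict_injective l.2.1 l'.2.1 (congrArg Subtype.val h))
  have : Finite S := Finite.of_injective φ hφ
  have := Fintype.ofFinite S
  let f : TLE F n D →ₗ[F] (S → F) :=
    (LinearMap.pi fun l : S => MvPolynomial.lcoeff F (listExponent n l.1)) ∘ₗ (TLE F n D).subtype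
  have hf : Function.Injective f := by
    rw [injective_iff_map_eq_zero]
    rintro ⟨p, hpT, hpD⟩ hp
    by_contra hne
    have h0 : p ≠ 0 := fun h => hne (Subtype.ext h)
    obtain ⟨l, hl, hln, hc⟩ := exists_strict_coeff_ne_zero (p := p) hpT h0
    refine hc (congrFun hp ⟨l, hl, hln, ?_⟩)
    have h1 := (MvPolynomial.le_totalDegree (MvPolynomial.mem_support_iff.2 hc)).trans
      ((MvPolynomial.mem_restrictTotalDegree _ _ _).1 hpD)
    refine le_trans (le_of_eq ?_) h1
    have h2 := congrArg Multiset.sum (map_listExponent hln)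
    rw [Finsupp.sum_fintype _ _ (by simp)]
    rw [Multiset.sum_add, Multiset.sum_replicate, smul_zero, add_zero, Multiset.sum_coe] at h2
    exact h2.symm
  refine ⟨FiniteDimensional.of_injective f hf,
    (LinearMap.finrank_le_finrank_of_injective hf).trans ?_⟩
  rw [Module.finrank_fintype_fun_eq_card, ← Nat.card_eq_fintype_card]
  exact Nat.card_le_card_of_injective φ hφ

/-! ### Products of complete homogeneous symmetric polynomials -/

section Alternants

variable {F : Type*} [Field F] {i : ℕ}

/-- Only the diagonal term of the determinant has strictly increasing exponents. -/
theorem coeff_det_X_pow (α β : Fin i → ℕ) (hα : StrictMono α) (hβ : StrictMono β) :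
    (Matrix.of fun a b : Fin i => (MvPolynomial.X b : MvPolynomial (Fin i) F) ^ (2 * α a)).det.coeff
      (Finsupp.equivFunOnFinite.symm fun a => 2 * β a) = if α = β then 1 else 0 := by
  have hterm : ∀ σ : Equiv.Perm (Fin i),
      ∏ a, (MvPolynomial.X a : MvPolynomial (Fin i) F) ^ (2 * α (σ a)) =
        MvPolynomial.monomial (Finsupp.equivFunOnFinite.symm fun a => 2 * α (σ a)) 1 := by
    intro σ
    rw [MvPolynomial.monomial_eq, Finsupp.prod_fintype _ _ (by simp)]
    simp
  have heq : ∀ σ : Equiv.Perm (Fin i),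
      (Finsupp.equivFunOnFinite.symm fun a => 2 * α (σ a)) =
        (Finsupp.equivFunOnFinite.symm fun a => 2 * β a) ↔ α = β ∧ σ = 1 := by
    intro σ
    rw [Equiv.apply_eq_iff_eq]
    constructor
    · intro h
      have h1 : α ∘ σ = β := by
        funext a
        have := congrFun h a
        simp only [Function.comp_apply] at this ⊢
        omega
      have h2 : α = β := by
        refine StrictMono.range_inj hα hβ |>.1 ?_
        rw [← h1, σ.surjective.range_comp]
      refine ⟨h2, Equiv.ext fun a => hα.injective ?_⟩
      rw [← h2] at h1
      exact congrFun h1 a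
    · rintro ⟨rfl, rfl⟩
      rfl
  rw [Matrix.det_apply, MvPolynomial.coeff_sum]
  simp only [Matrix.of_apply, hterm, Units.smul_def, zsmul_eq_mul]
  rw [Finset.sum_eq_single 1]
  · by_cases h : α = β
    · simp [h]
    · simp only [Equiv.Perm.sign_one, Units.val_one, Int.cast_one, one_mul, if_neg h]
      rw [MvPolynomial.coeff_monomial, if_neg]
      exact fun hh => h ((heq 1).1 hh).1
  · intro σ _ hσ
    rw [← zsmul_eq_mul, MvPolynomial.coeff_smul, MvPolynomial.coeff_monomial, if_neg, smul_zero]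
    rw [heq]
    exact fun h => hσ h.2
  · simp

theorem linearIndependent_det_X_pow : LinearIndependent F
    fun α : {α : Fin i → ℕ // StrictMono α} =>
      (Matrix.of fun a b : Fin i =>
        (MvPolynomial.X b : MvPolynomial (Fin i) F) ^ (2 * α.1 a)).det := by
  rw [linearIndependent_iff']
  intro S c hc β hβ
  have := congrArg (MvPolynomial.coeff (Finsupp.equivFunOnFinite.symm fun a => 2 * β.1 a)) hc
  rw [MvPolynomial.coeff_sum, Finset.sum_eq_single β] at this
  · simpa [coeff_det_X_pow _ _ β.2 β.2] using this
  · intro α _ hα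
    have : α.1 ≠ β.1 := fun h => hα (Subtype.ext h)
    simp [coeff_det_X_pow _ _ α.2 β.2, this]
  · exact fun h => absurd hβ h

end Alternants

section Remainder

variable {L : Type*} [Field L] {i : ℕ}

/-- The coefficient of `X ^ l` in the remainder of `X ^ k` modulo `∏ (X - η b)`, computed by Lagrange
interpolation, for distinct `η b`. For `l + 1 = i` and `k ≥ l` it is the complete homogeneous
symmetric polynomial of degree `k - l` in the `η b`. -/
noncomputable def remCoeff (η : Fin i → L) (l k : ℕ) : L :=
  ∑ b, (Lagrange.basis Finset.univ η b).coeff l * η b ^ k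

theorem remCoeff_of_lt {η : Fin i → L} (hη : Function.Injective η) {l k : ℕ} (hk : k < i) :
    remCoeff η l k = if l = k then 1 else 0 := by
  have h := Lagrange.eq_interpolate (s := Finset.univ) (v := η) (f := Polynomial.X ^ k)
    hη.injOn (by simpa using hk)
  have h' := congrArg (fun p => Polynomial.coeff p l) h
  simp only [Polynomial.coeff_X_pow, Lagrange.interpolate_apply, Polynomial.finsetSum_coeff,
    Polynomial.coeff_C_mul, Polynomial.eval_pow, Polynomial.eval_X] at h'
  rw [h', remCoeff]
  exact Finset.sum_congr rfl fun b _ => mul_comm _ _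

variable {F : Type*} [Field F] [Algebra F L]

/-- The Jacobi–Trudi determinant of the `h_λ` is, up to a nonzero factor, an alternant. -/
theorem det_remCoeff (η : Fin i → L) (α : Fin i → ℕ) :
    (Matrix.of fun a b : Fin i => remCoeff η (i - 1) (α a + b)).det =
      (Matrix.of fun a b : Fin i => η b ^ α a).det *
        ((∏ b, (Lagrange.basis Finset.univ η b).coeff (i - 1)) * (Matrix.vandermonde η).det) := by
  rw [← Matrix.det_mul_column, ← Matrix.det_mul]
  congr 1
  ext a b
  simp only [Matrix.of_apply, Matrix.mul_apply, Matrix.vandermonde_apply, remCoeff, pow_add]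
  exact Finset.sum_congr rfl fun c _ => by ring

/-- The products `h_λ` of at most `i` complete homogeneous symmetric polynomials in `i` variables
are linearly independent: their span in bounded degree contains the Jacobi–Trudi determinants,
which are independent and as numerous as the `h_λ`. -/
theorem linearIndependent_prod_remCoeff {η : Fin i → L} (hη : Function.Injective η)
    (halt : LinearIndependent F fun α : {α : Fin i → ℕ // StrictMono α} =>
      (Matrix.of fun a b : Fin i => η b ^ α.1 a).det) :
    LinearIndependent F fun ν : {ν : Fin i → ℕ // Monotone ν} =>
      ∏ a, remCoeff η (i - 1) (ν.1 a + (i - 1)) := by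
  have hD : (∏ b, (Lagrange.basis Finset.univ η b).coeff (i - 1)) *
      (Matrix.vandermonde η).det ≠ 0 := by
    refine mul_ne_zero (Finset.prod_ne_zero_iff.2 fun b _ => ?_)
      (Matrix.det_vandermonde_ne_zero_iff.2 hη)
    have h1 := Lagrange.natDegree_basis (s := Finset.univ) hη.injOn (Finset.mem_univ b)
    rw [Finset.card_univ, Fintype.card_fin] at h1
    rw [← h1, Polynomial.coeff_natDegree, Polynomial.leadingCoeff_ne_zero]
    exact Lagrange.basis_ne_zero hη.injOn (Finset.mem_univ b)
  rw [linearIndependent_iff_finset_linearIndependent]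
  intro S
  set N := S.sup fun ν => ∑ a, ν.1 a with hN
  let I := {ν : Fin i → ℕ // Monotone ν ∧ ∑ a, ν a ≤ N}
  have : Finite I := by
    refine ((Set.finite_Iic (fun _ : Fin i => N)).subset ?_).to_subtype (s := {ν | _})
    intro ν hν a
    exact (Finset.single_le_sum (f := ν) (fun _ _ => Nat.zero_le _) (Finset.mem_univ a)).trans hν.2
  have := Fintype.ofFinite I
  let h : I → L := fun ν => ∏ a, remCoeff η (i - 1) (ν.1 a + (i - 1))
  suffices hI : LinearIndependent F h by
    refine hI.comp (fun ν : S => (⟨ν.1.1, ν.1.2, ?_⟩ : I)) ?_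
    · exact Finset.le_sup (f := fun ν : {ν : Fin i → ℕ // Monotone ν} => ∑ a, ν.1 a) ν.2
    · intro ν ν' hν
      exact Subtype.ext (Subtype.ext (congrArg (fun x : I => x.1) hν))
  -- the Jacobi–Trudi determinants, indexed by the same partitions
  let g : I → L := fun ν =>
    (Matrix.of fun a b : Fin i => remCoeff η (i - 1) (ν.1 a + a + b)).det
  have hg : LinearIndependent F g := by
    have h1 := (halt.comp (fun ν : I => ⟨fun a => ν.1 a + (a : ℕ), fun a b hab =>
        add_lt_add_of_le_of_lt (ν.2.1 hab.le) hab⟩) (by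
          intro ν ν' hν
          refine Subtype.ext (funext fun a => ?_)
          simpa using congrFun (congrArg Subtype.val hν) a)).map_injOn
      (LinearMap.mulRight F ((∏ b, (Lagrange.basis Finset.univ η b).coeff (i - 1)) *
        (Matrix.vandermonde η).det)) (fun x _ y _ hxy => mul_right_cancel₀ hD hxy)
    have h2 : g = _ := funext fun ν => det_remCoeff η fun a => ν.1 a + a
    rw [h2]
    exact h1
  have hgh : ∀ ν, g ν ∈ Submodule.span F (Set.range h) := by
    intro ν
    simp only [g, Matrix.det_apply]
    refine Submodule.sum_mem _ fun σ _ => ?_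
    rw [Units.smul_def]
    refine zsmul_mem ?_ _
    simp only [Matrix.of_apply]
    by_cases hlow : ∃ a, ν.1 (σ a) + (σ a : ℕ) + a < i - 1
    · obtain ⟨a, ha⟩ := hlow
      rw [Finset.prod_eq_zero (Finset.mem_univ a)]
      · exact Submodule.zero_mem _
      · rw [remCoeff_of_lt hη (by omega), if_neg (by omega)]
    · push Not at hlow
      let μ : Fin i → ℕ := fun a => ν.1 (σ a) + (σ a : ℕ) + a - (i - 1)
      have hμ : ∀ a, μ a + (i - 1) = ν.1 (σ a) + (σ a : ℕ) + a := fun a =>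
        Nat.sub_add_cancel (hlow a)
      have hsum : ∑ a, μ a = ∑ a, ν.1 a := by
        have h1 : ∑ a, (μ a + (i - 1)) = ∑ a, (ν.1 (σ a) + (σ a : ℕ) + a) :=
          Finset.sum_congr rfl fun a _ => hμ a
        rw [Finset.sum_add_distrib, Finset.sum_add_distrib, Finset.sum_add_distrib,
          Equiv.sum_comp σ ν.1, Equiv.sum_comp σ (fun a : Fin i => (a : ℕ)), Finset.sum_const,
          Finset.card_univ, Fintype.card_fin, Fin.sum_univ_eq_sum_range (fun a => a)] at h1
        have h2 := Finset.sum_range_id_mul_two i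
        rw [smul_eq_mul] at h1
        omega
      refine Submodule.subset_span ⟨⟨μ ∘ Tuple.sort μ, Tuple.monotone_sort μ, ?_⟩, ?_⟩
      · simp only [Function.comp_apply]
        rw [Equiv.sum_comp (Tuple.sort μ) μ, hsum]
        exact ν.2.2
      · simp only [h, Function.comp_apply]
        rw [Equiv.prod_comp (Tuple.sort μ) fun a => remCoeff η (i - 1) (μ a + (i - 1))]
        exact Finset.prod_congr rfl fun a _ => by rw [hμ]
  have := FiniteDimensional.span_of_finite F (Set.finite_range h)
  rw [linearIndependent_iff_card_le_finrank_span]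
  rw [← finrank_span_eq_card hg]
  exact Submodule.finrank_mono (Submodule.span_le.2 (by rintro _ ⟨ν, rfl⟩; exact hgh ν))

/-- The same independence, with the `h_λ` indexed by multisets. -/
theorem linearIndependent_multiset_prod_remCoeff {η : Fin i → L} (hη : Function.Injective η)
    (halt : LinearIndependent F fun α : {α : Fin i → ℕ // StrictMono α} =>
      (Matrix.of fun a b : Fin i => η b ^ α.1 a).det) :
    LinearIndependent F fun s : {s : Multiset ℕ // s.card ≤ i ∧ ∀ k ∈ s, i ≤ k} =>
      (s.1.map (remCoeff η (i - 1))).prod := by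
  -- pad the multiset with zeros to `i` elements and sort it
  have hex : ∀ s : {s : Multiset ℕ // s.card ≤ i ∧ ∀ k ∈ s, i ≤ k},
      ∃ ν : Fin i → ℕ, Monotone ν ∧ Finset.univ.val.map ν =
        s.1.map (fun k => k - (i - 1)) + Multiset.replicate (i - s.1.card) 0 := by
    intro s
    set t := s.1.map (fun k => k - (i - 1)) + Multiset.replicate (i - s.1.card) 0 with ht
    have hc : t.card = i := by
      have := s.2.1
      simp [ht]; omega
    have hl : (t.sort (· ≤ ·)).length = i := by simp [hc]
    refine ⟨fun a => (t.sort (· ≤ ·)).get (a.cast hl.symm), ?_, ?_⟩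
    · intro a b hab
      exact (Multiset.pairwise_sort t (· ≤ ·)).rel_get_of_le (R := (· ≤ ·)) hab
    · rw [Fin.univ_val_map]
      conv_rhs => rw [← Multiset.sort_eq t (· ≤ ·)]
      congr 1
      apply List.ext_getElem
      · simp [hc]
      · intro n h1 h2
        simp
  choose ν hν hmap using hex
  have h := (linearIndependent_prod_remCoeff hη halt).comp (fun s => ⟨ν s, hν s⟩) (by
    intro s s' hs
    have h1 : ν s = ν s' := congrArg Subtype.val hs
    have h2 := hmap s
    rw [h1, hmap s'] at h2
    have h3 := congrArg (Multiset.filter (0 < ·)) h2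
    have hr : ∀ k : ℕ, Multiset.filter (0 < ·) (Multiset.replicate k 0) = 0 := by
      intro k; simp [Multiset.filter_eq_nil, Multiset.mem_replicate]
    have hf : ∀ s : {s : Multiset ℕ // s.card ≤ i ∧ ∀ k ∈ s, i ≤ k},
        Multiset.filter (0 < ·) (s.1.map fun k => k - (i - 1)) = s.1.map fun k => k - (i - 1) := by
      intro s
      rw [Multiset.filter_eq_self]
      intro a ha
      obtain ⟨k, hk, rfl⟩ := Multiset.mem_map.1 ha
      have := s.2.2 k hk
      have : 0 < i := by
        have := (Multiset.card_pos_iff_exists_mem.2 ⟨k, hk⟩).trans_le s.2.1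
        exact this
      omega
    rw [Multiset.filter_add, Multiset.filter_add, hr, hr, hf, hf, add_zero, add_zero] at h3
    have hb : ∀ s : {s : Multiset ℕ // s.card ≤ i ∧ ∀ k ∈ s, i ≤ k},
        (s.1.map fun k => k - (i - 1)).map (fun k => k + (i - 1)) = s.1 := by
      intro s
      rw [Multiset.map_map]
      conv_rhs => rw [← Multiset.map_id s.1]
      refine Multiset.map_congr rfl fun k hk => ?_
      have := s.2.2 k hk
      simp only [Function.comp_apply, id_eq]
      omega
    exact Subtype.ext (by rw [← hb s, ← h3, hb s']))
  convert h using 1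
  funext s
  have h1 : ∏ a, remCoeff η (i - 1) (ν s a + (i - 1)) =
      ((Finset.univ.val.map (ν s)).map fun q => remCoeff η (i - 1) (q + (i - 1))).prod := by
    rw [Multiset.map_map]; rfl
  simp only [Function.comp_apply]
  rw [h1, hmap, Multiset.map_add, Multiset.prod_add, Multiset.map_map, Multiset.map_replicate,
    Multiset.prod_replicate, zero_add]
  have h2 : remCoeff η (i - 1) (i - 1) ^ (i - s.1.card) = 1 := by
    rcases Nat.eq_zero_or_pos i with h0 | h0
    · rw [show i - s.1.card = 0 by omega, pow_zero]
    · rw [remCoeff_of_lt hη (by omega), if_pos rfl, one_pow]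
  rw [h2, mul_one]
  refine congrArg _ (Multiset.map_congr rfl fun k hk => ?_)
  have := s.2.2 k hk
  simp only [Function.comp_apply]
  rw [Nat.sub_add_cancel (by omega)]

end Remainder

/-! ### Independence of the lowest coefficients -/

section LinearIndependence

variable {F : Type*} [Field F]

/-- A family of monomials is linearly independent over `F` if the coefficients attached to each
exponent are. -/
theorem linearIndependent_monomial {ι σ L : Type*} [CommRing L] [Algebra F L] (α : ι → σ →₀ ℕ)
    (g : ι → L) (h : ∀ d, LinearIndependent F fun s : {s // α s = d} => g s) :
    LinearIndependent F fun s => MvPolynomial.monomial (α s) (g s) := by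
  classical
  rw [linearIndependent_iff']
  intro S c hc s hs
  have h1 := congrArg (MvPolynomial.coeff (α s)) hc
  simp only [MvPolynomial.coeff_sum, MvPolynomial.coeff_smul, MvPolynomial.coeff_monomial,
    MvPolynomial.coeff_zero, smul_ite, smul_zero] at h1
  rw [← Finset.sum_filter, ← Finset.sum_subtype_eq_sum_filter] at h1
  exact linearIndependent_iff'.1 (h (α s)) _ (fun t => c t.1) h1 ⟨s, rfl⟩ (by simpa using hs)

/-- A family of polynomials in `θ` is linearly independent if their lowest coefficients are. -/
theorem linearIndependent_of_lowest {ι B : Type*} [CommRing B] [Algebra F B] (w : ι → ℕ) (b : ι → B)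
    (hb : LinearIndependent F b) (y : ι → Polynomial B)
    (hy : ∀ s, ∃ r, y s = Polynomial.X ^ w s * (Polynomial.C (b s) + Polynomial.X * r)) :
    LinearIndependent F y := by
  classical
  rw [linearIndependent_iff']
  intro S c hc s hs
  by_contra hcs
  obtain ⟨t, ht, htmin⟩ := (S.filter fun s => c s ≠ 0).exists_min_image w
    ⟨s, Finset.mem_filter.2 ⟨hs, hcs⟩⟩
  have h1 := congrArg (fun p => Polynomial.coeff p (w t)) hc
  simp only [Polynomial.finsetSum_coeff, Polynomial.coeff_smul, Polynomial.coeff_zero] at h1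
  have h2 : ∑ s ∈ S, (if w s = w t then c s else 0) • b s = 0 := by
    rw [← h1]
    refine Finset.sum_congr rfl fun s hs => ?_
    by_cases h0 : c s = 0
    · simp [h0]
    obtain ⟨r, hr⟩ := hy s
    rw [hr, Polynomial.coeff_X_pow_mul']
    have hle := htmin s (Finset.mem_filter.2 ⟨hs, h0⟩)
    by_cases hw : w s = w t
    · simp [hw]
    · rw [if_neg hw, if_neg (by omega), zero_smul, smul_zero]
  have h3 := linearIndependent_iff'.1 hb S _ h2 t (Finset.mem_filter.1 ht).1
  rw [if_pos rfl] at h3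
  exact (Finset.mem_filter.1 ht).2 h3

/-- The lowest coefficients, in the degeneration used below, of the power sums `p_{2m+1}`: free
variables `X m` for `m ≤ j`, and multiples of `X j` times a complete symmetric polynomial for
`m > j`. -/
noncomputable def leadPsum {L : Type*} [Field L] {i : ℕ} (η : Fin i → L) (e j m : ℕ) :
    MvPolynomial ℕ L :=
  if m ≤ j then MvPolynomial.X m
  else MvPolynomial.C ((2 * m + 1) / (2 * j + 1) * remCoeff η (i - 1) (m - e)) * MvPolynomial.X j

/-- The lowest coefficients of the proper products are linearly independent. The exponent of the
free variables records the elements of the multiset up to `j` and the number of the others, and the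
coefficient is a nonzero multiple of a product of at most `i` complete symmetric polynomials. -/
theorem linearIndependent_prod_leadPsum [CharZero F] {L : Type*} [Field L] [Algebra F L] {i e j : ℕ}
    (hj : j + 1 = i + e) {η : Fin i → L} (hη : Function.Injective η)
    (halt : LinearIndependent F fun α : {α : Fin i → ℕ // StrictMono α} =>
      (Matrix.of fun a b : Fin i => η b ^ α.1 a).det) :
    LinearIndependent F fun s : {s : Multiset ℕ // (s.filter fun m => j < m).card ≤ i} =>
      (s.1.map (leadPsum η e j)).prod := by
  have hodd : ∀ m : ℕ, (2 * m + 1 : F) ≠ 0 := fun m => by exact_mod_cast Nat.succ_ne_zero (2 * m)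
  let κ : ℕ → F := fun m => if m ≤ j then 1 else (2 * m + 1) / (2 * j + 1)
  have hκ : ∀ m, κ m ≠ 0 := by
    intro m
    simp only [κ]
    split_ifs
    · exact one_ne_zero
    · exact div_ne_zero (hodd m) (hodd j)
  let g₀ : Multiset ℕ → L := fun s =>
    ((s.filter fun m => j < m).map fun m => remCoeff η (i - 1) (m - e)).prod
  have hprod : ∀ s : Multiset ℕ, (s.map (leadPsum η e j)).prod =
      MvPolynomial.monomial (Multiset.toFinsupp (s.map (min · j))) ((s.map κ).prod • g₀ s) := by
    intro s
    induction s using Multiset.induction_on with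
    | empty => simp [g₀]
    | cons m s ih =>
      rw [Multiset.map_cons, Multiset.prod_cons, ih, Multiset.map_cons, ← Multiset.singleton_add,
        map_add, Multiset.toFinsupp_singleton, Multiset.map_cons, Multiset.prod_cons]
      by_cases hm : m ≤ j
      · have h1 : g₀ (m ::ₘ s) = g₀ s := by
          simp only [g₀]
          rw [Multiset.filter_cons_of_neg _ (by omega)]
        rw [h1, leadPsum, if_pos hm, min_eq_left hm, MvPolynomial.X,
          MvPolynomial.monomial_mul, one_mul]
        simp [κ, hm]
      · have h1 : g₀ (m ::ₘ s) = remCoeff η (i - 1) (m - e) * g₀ s := by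
          simp only [g₀]
          rw [Multiset.filter_cons_of_pos _ (by omega), Multiset.map_cons, Multiset.prod_cons]
        rw [h1, leadPsum, if_neg hm, min_eq_right (by omega), MvPolynomial.X,
          MvPolynomial.C_mul_monomial, MvPolynomial.monomial_mul]
        congr 1
        simp only [κ, if_neg hm, Algebra.smul_def, map_mul, map_div₀, map_add, map_one,
          map_natCast, map_ofNat]
        ring
  simp only [hprod]
  refine linearIndependent_monomial _ _ fun d => ?_
  -- for a given exponent, the multiset is determined by its elements greater than `j`
  let φ : {s : {s : Multiset ℕ // (s.filter fun m => j < m).card ≤ i} //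
      Multiset.toFinsupp (s.1.map (min · j)) = d} →
      {s : Multiset ℕ // s.card ≤ i ∧ ∀ k ∈ s, i ≤ k} := fun s =>
    ⟨(s.1.1.filter fun m => j < m).map (· - e), by simpa using s.1.2, by
      intro k hk
      obtain ⟨m, hm, rfl⟩ := Multiset.mem_map.1 hk
      have := (Multiset.mem_filter.1 hm).2
      omega⟩
  have hφ : Function.Injective φ := by
    intro s t hst
    have h1 : (s.1.1.filter fun m => j < m) = t.1.1.filter fun m => j < m := by
      have h2 := congrArg (Multiset.map (· + e)) (congrArg Subtype.val hst)
      have h3 : ∀ s : Multiset ℕ, ((s.filter fun m => j < m).map (· - e)).map (· + e) =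
          s.filter fun m => j < m := by
        intro s
        rw [Multiset.map_map]
        conv_rhs => rw [← Multiset.map_id (s.filter fun m => j < m)]
        refine Multiset.map_congr rfl fun m hm => ?_
        have := (Multiset.mem_filter.1 hm).2
        simp only [Function.comp_apply, id_eq]
        omega
      simp only [φ] at h2
      rwa [h3, h3] at h2
    have h2 : s.1.1.map (min · j) = t.1.1.map (min · j) :=
      Multiset.toFinsupp.injective (s.2.trans t.2.symm)
    have h3 : ∀ s : Multiset ℕ, s.map (min · j) =
        (s.filter fun m => ¬ j < m) + Multiset.replicate (s.filter fun m => j < m).card j := by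
      intro s
      conv_lhs => rw [← Multiset.filter_add_not (fun m => j < m) s]
      rw [Multiset.map_add, add_comm]
      congr 1
      · conv_rhs => rw [← Multiset.map_id (s.filter fun m => ¬ j < m)]
        refine Multiset.map_congr rfl fun m hm => ?_
        have := (Multiset.mem_filter.1 hm).2
        simp only [id_eq]
        omega
      · rw [← Multiset.map_const']
        refine Multiset.map_congr rfl fun m hm => ?_
        have := (Multiset.mem_filter.1 hm).2
        omega
    rw [h3, h3, h1, add_left_inj] at h2
    refine Subtype.ext (Subtype.ext ?_)
    rw [← Multiset.filter_add_not (fun m => j < m) s.1.1, h1, h2, Multiset.filter_add_not]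
  have h := ((linearIndependent_multiset_prod_remCoeff hη halt).comp φ hφ).units_smul
    fun s => Units.mk0 (s.1.1.map κ).prod (by
      rw [Ne, Multiset.prod_eq_zero_iff, Multiset.mem_map]
      rintro ⟨m, -, hm⟩
      exact hκ m hm)
  convert h using 1
  funext s
  rw [Pi.smul_apply', Units.smul_mk0, Function.comp_apply, Multiset.map_map]
  rfl

end LinearIndependence

/-! ### Degeneration of the variables -/

section Degeneration

/-- The points `y + θ² u, - y`, together with `θ² z` in the odd case `e = 1`, to first order. -/
theorem psum_append_eq {A : Type*} [CommRing A] {i e : ℕ} (y u : Fin i → A) (θ z : A) (m : ℕ) :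
    ∃ q, ∑ k, Fin.append (Fin.append (fun b => y b + θ ^ 2 * u b) (fun b => -y b))
        (fun _ : Fin e => θ ^ 2 * z) k ^ (2 * m + 1) =
      θ ^ 2 * ((2 * m + 1) * ∑ b, u b * y b ^ (2 * m) + if m = 0 then e * z else 0) +
        θ ^ 4 * q := by
  have h1 : ∀ b, ∃ q, (y b + θ ^ 2 * u b) ^ (2 * m + 1) + (-y b) ^ (2 * m + 1) =
      θ ^ 2 * ((2 * m + 1) * (u b * y b ^ (2 * m))) + θ ^ 4 * q := by
    intro b
    obtain ⟨q, hq⟩ := Polynomial.powAddExpansion (y b) (θ ^ 2 * u b) (2 * m + 1)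
    refine ⟨q * u b ^ 2, ?_⟩
    rw [hq, Odd.neg_pow ⟨m, rfl⟩]
    push_cast
    ring
  choose q hq using h1
  have h2 : ∃ q', (e : A) * (θ ^ 2 * z) ^ (2 * m + 1) =
      θ ^ 2 * (if m = 0 then e * z else 0) + θ ^ 4 * q' := by
    rcases m with _ | m
    · exact ⟨0, by simp; ring⟩
    · refine ⟨e * θ ^ 2 * z ^ 3 * (θ ^ 2 * z) ^ (2 * m), ?_⟩
      rw [if_neg (Nat.succ_ne_zero m)]
      ring
  obtain ⟨q', hq'⟩ := h2
  refine ⟨∑ b, q b + q', ?_⟩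
  rw [Fin.sum_univ_add, Fin.sum_univ_add]
  simp only [Fin.append_left, Fin.append_right]
  rw [← Finset.sum_add_distrib, Finset.sum_congr rfl fun b _ => hq b, Finset.sum_const,
    Finset.card_univ, Fintype.card_fin, nsmul_eq_mul, hq', Finset.sum_add_distrib,
    ← Finset.mul_sum, ← Finset.mul_sum, ← Finset.mul_sum]
  ring

/-- Points of the form considered in `psum_append_eq` whose first-order odd power sums `p_{2m+1}`,
`m ≤ j`, take prescribed values `t m`. This is Lagrange interpolation at the squares `y b ^ 2`. -/
theorem exists_prescribed_psum {L A : Type*} [Field L] [CharZero L] [CommRing A] [Algebra L A]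
    {i e j : ℕ} (hj : j + 1 = i + e) (he : e ≤ 1) (y : Fin i → L) (hy : ∀ b, y b ≠ 0)
    (hη : Function.Injective fun b => y b ^ 2) (t : ℕ → A) :
    ∃ (u : Fin i → A) (z : A),
      (∀ m ≤ j, (2 * m + 1) * ∑ b, u b * algebraMap L A (y b) ^ (2 * m) +
        (if m = 0 then e * z else 0) = t m) ∧
      ∀ m > j, (2 * m + 1) * ∑ b, u b * algebraMap L A (y b) ^ (2 * m) +
        (if m = 0 then e * z else 0) =
        (2 * m + 1) * ∑ l : Fin i, algebraMap L A
          ((2 * ((l + e : ℕ) : L) + 1)⁻¹ * remCoeff (fun b => y b ^ 2) l (m - e)) * t (l + e) := by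
  have hodd : ∀ m : ℕ, (2 * m + 1 : L) ≠ 0 := fun m => by exact_mod_cast Nat.succ_ne_zero (2 * m)
  -- for `e = 1` the equations for `m ≥ 1` involve the exponents `2, 4, …` of `y b`, so the Lagrange
  -- coefficients determine `u b * y b ^ 2`, and `p_1` is adjusted by `z`
  let u : Fin i → A := fun b => ∑ l : Fin i, algebraMap L A
    (((y b) ^ (2 * e))⁻¹ * (Lagrange.basis Finset.univ (fun b => y b ^ 2) b).coeff l *
      (2 * ((l + e : ℕ) : L) + 1)⁻¹) * t (l + e)
  have hu : ∀ m, e ≤ m → ∑ b, u b * algebraMap L A (y b) ^ (2 * m) =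
      ∑ l : Fin i, algebraMap L A
          ((2 * ((l + e : ℕ) : L) + 1)⁻¹ * remCoeff (fun b => y b ^ 2) l (m - e)) * t (l + e) := by
    intro m hm
    obtain ⟨k, rfl⟩ := Nat.exists_eq_add_of_le hm
    simp only [u, Finset.sum_mul]
    rw [Finset.sum_comm]
    refine Finset.sum_congr rfl fun l _ => ?_
    rw [remCoeff, Finset.mul_sum, map_sum, Finset.sum_mul]
    refine Finset.sum_congr rfl fun b _ => ?_
    rw [← map_pow, mul_right_comm, ← map_mul, Nat.add_sub_cancel_left]
    congr 2
    have := hy b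
    rw [mul_add 2 e k, pow_add, ← pow_mul]
    field_simp
  refine ⟨u, t 0 - ∑ b, u b, fun m hm => ?_, fun m hm => ?_⟩
  · by_cases hme : e ≤ m
    · have h1 : (if m = 0 then (e : A) * (t 0 - ∑ b, u b) else 0) = 0 := by
        split_ifs with h
        · rw [show e = 0 by omega]; simp
        · rfl
      rw [h1, hu m hme, add_zero, Finset.sum_eq_single (⟨m - e, by omega⟩ : Fin i)]
      · rw [remCoeff_of_lt hη (by omega)]
        simp only [Nat.sub_add_cancel hme, if_true, mul_one]
        have h2 : (2 * m + 1 : A) = algebraMap L A (2 * m + 1) := by simp [map_ofNat]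
        rw [← mul_assoc, h2, ← map_mul, mul_inv_cancel₀ (hodd m), map_one, one_mul]
      · intro l _ hl
        rw [remCoeff_of_lt hη (by omega), if_neg]
        · simp
        · exact fun h => hl (Fin.ext h)
      · simp
    · obtain rfl : e = 1 := by omega
      obtain rfl : m = 0 := by omega
      simp
  · rw [hu m (by omega), if_neg (by omega), add_zero]

/-- A degeneration of the `n = 2 i + e` variables in which the odd power sums have the lowest
coefficients `leadPsum`. The power sums `p_{2m+1}` with `m < j` are given the higher order `3` in `θ`, so
that they do not contribute to the lowest coefficients of those with `m > j`. -/
theorem exists_degeneration {L : Type*} [Field L] [CharZero L] {i e j : ℕ} (he : e ≤ 1)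
    (hj : j + 1 = i + e) (y : Fin i → L) (hy : ∀ b, y b ≠ 0)
    (hη : Function.Injective fun b => y b ^ 2) :
    ∃ x : Fin (i + i + e) → Polynomial (MvPolynomial ℕ L), ∀ m, ∃ r,
      ∑ k, x k ^ (2 * m + 1) = Polynomial.X ^ (if m < j then 3 else 2) *
        (Polynomial.C (leadPsum (fun b => y b ^ 2) e j m) + Polynomial.X * r) := by
  generalize hθ : (Polynomial.X : Polynomial (MvPolynomial ℕ L)) = θ
  let c : L →+* Polynomial (MvPolynomial ℕ L) := algebraMap L _
  have hc : ∀ a : L, c a = Polynomial.C (MvPolynomial.C a) := fun _ => rfl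
  -- the values prescribed to the small power sums, after division by `θ ^ 2`
  let t : ℕ → Polynomial (MvPolynomial ℕ L) := fun m => if m = j then
    Polynomial.C (MvPolynomial.X j) else θ * Polynomial.C (MvPolynomial.X m)
  have htj : t j = Polynomial.C (MvPolynomial.X j) := if_pos rfl
  have ht : ∀ m, m ≠ j → t m = θ * Polynomial.C (MvPolynomial.X m) := fun m hm => if_neg hm
  obtain ⟨u, z, hsmall, hbig⟩ := exists_prescribed_psum hj he y hy hη t
  refine ⟨Fin.append (Fin.append (fun b => c (y b) + θ ^ 2 * u b) fun b => -c (y b))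
    fun _ => θ ^ 2 * z, fun m => ?_⟩
  obtain ⟨q, hq⟩ := psum_append_eq (e := e) (fun b => c (y b)) u θ z m
  rw [hq]
  clear hq hθ
  clear_value t
  rcases lt_trichotomy m j with hm | rfl | hm
  · refine ⟨q, ?_⟩
    rw [hsmall m hm.le, ht m hm.ne, leadPsum, if_pos hm, if_pos hm.le]
    ring
  · refine ⟨θ * q, ?_⟩
    rw [hsmall m le_rfl, htj, leadPsum, if_neg (lt_irrefl m), if_pos le_rfl]
    ring
  · rw [hbig m hm, if_neg hm.not_gt]
    clear hbig hsmall
    obtain ⟨r, hr⟩ : ∃ r, (2 * m + 1) * ∑ l : Fin i, c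
        ((2 * ((l + e : ℕ) : L) + 1)⁻¹ * remCoeff (fun b => y b ^ 2) l (m - e)) * t (l + e) =
        Polynomial.C (leadPsum (fun b => y b ^ 2) e j m) + θ * r := by
      rcases i with _ | i
      · exact ⟨0, by simp [leadPsum, hm.not_ge, remCoeff]⟩
      · have hij : i + e = j := by omega
        refine ⟨(2 * m + 1) * ∑ l : Fin i, c ((2 * ((l + e : ℕ) : L) + 1)⁻¹ *
          remCoeff (fun b => y b ^ 2) l (m - e)) * Polynomial.C (MvPolynomial.X (l + e)), ?_⟩
        have h1 : ∀ l : Fin i, t (l + e) = θ * Polynomial.C (MvPolynomial.X (l + e)) :=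
          fun l => ht _ (by omega)
        have h3 : (2 * m + 1 : Polynomial (MvPolynomial ℕ L)) = c (2 * m + 1) := by
          simp [map_ofNat]
        rw [Fin.sum_univ_castSucc]
        simp only [Fin.val_castSucc, Fin.val_last, h1]
        rw [hij, htj, leadPsum, if_neg hm.not_ge, mul_add, add_comm]
        congr 1
        · rw [h3, ← mul_assoc, ← map_mul, hc, ← Polynomial.C_mul, Nat.add_sub_cancel, ← mul_assoc,
            ← div_eq_mul_inv]
        · simp only [Finset.mul_sum]
          exact Finset.sum_congr rfl fun l _ => by ring
    refine ⟨r + θ * q, ?_⟩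
    have hr' : (2 * m + 1) * ∑ l : Fin i, algebraMap L (Polynomial (MvPolynomial ℕ L))
        ((2 * ((l + e : ℕ) : L) + 1)⁻¹ * remCoeff (fun b => y b ^ 2) l (m - e)) * t (l + e) =
        Polynomial.C (leadPsum (fun b => y b ^ 2) e j m) + θ * r := hr
    rw [hr']
    ring

theorem linearIndependent_oddProd_of_alternants {F L : Type*} [Field F] [CharZero F] [Field L]
    [CharZero L] [Algebra F L] {i e j : ℕ} (he : e ≤ 1) (hj : j + 1 = i + e) (y : Fin i → L)
    (hy : ∀ b, y b ≠ 0) (hη : Function.Injective fun b => y b ^ 2)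
    (halt : LinearIndependent F fun α : {α : Fin i → ℕ // StrictMono α} =>
      (Matrix.of fun a b : Fin i => (y b ^ 2) ^ α.1 a).det) :
    LinearIndependent F fun s : {s : Multiset ℕ // IsProper (i + i + e) s} =>
      oddProd F (i + i + e) s.1 := by
  have hiI : iIdx (i + i + e) = i := by unfold iIdx; omega
  have hjI : jIdx (i + i + e) = j := by unfold jIdx; omega
  obtain ⟨x, hx⟩ := exists_degeneration he hj y hy hη
  let w : ℕ → ℕ := fun m => if m < j then 3 else 2
  let b : ℕ → MvPolynomial ℕ L := leadPsum (fun b => y b ^ 2) e j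
  have hprod : ∀ s : Multiset ℕ, ∃ r, (s.map fun m => ∑ k, x k ^ (2 * m + 1)).prod =
      Polynomial.X ^ (s.map w).sum * (Polynomial.C (s.map b).prod + Polynomial.X * r) := by
    intro s
    induction s using Multiset.induction_on with
    | empty => exact ⟨0, by simp⟩
    | cons m s ih =>
      obtain ⟨r, hr⟩ := ih
      obtain ⟨r', hr'⟩ := hx m
      simp only [Multiset.map_cons, Multiset.prod_cons, Multiset.sum_cons, Polynomial.C_mul]
      rw [hr, hr', pow_add]
      exact ⟨Polynomial.C (b m) * r + r' * Polynomial.C (s.map b).prod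
        + Polynomial.X * r' * r, by ring⟩
  refine LinearIndependent.of_comp (MvPolynomial.aeval x).toLinearMap ?_
  refine linearIndependent_of_lowest (fun s => (s.1.map w).sum)
    (fun s => (s.1.map b).prod) ?_ _ fun s => ?_
  · refine (linearIndependent_prod_leadPsum hj hη halt).comp
      (fun s : {s : Multiset ℕ // IsProper (i + i + e) s} => ⟨s.1, ?_⟩) ?_
    · have := s.2
      rwa [IsProper, hiI, hjI] at this
    · intro s s' h
      exact Subtype.ext (Subtype.mk.inj h)
  · obtain ⟨r, hr⟩ := hprod s.1
    refine ⟨r, ?_⟩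
    rw [← hr, Function.comp_apply, AlgHom.toLinearMap_apply, oddProd, map_multiset_prod,
      Multiset.map_map]
    congr 1
    refine Multiset.map_congr rfl fun m _ => ?_
    simp [MvPolynomial.psum]

theorem linearIndependent_oddProd (F : Type*) [Field F] [CharZero F] {n : ℕ} (hn : 0 < n) :
    LinearIndependent F fun s : {s : Multiset ℕ // IsProper n s} => oddProd F n s.1 := by
  obtain ⟨i, e, j, he, hj, rfl⟩ : ∃ i e j, e ≤ 1 ∧ j + 1 = i + e ∧ n = i + i + e :=
    ⟨n / 2, n % 2, (n - 1) / 2, by omega, by omega, by omega⟩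
  let φ := IsScalarTower.toAlgHom F (MvPolynomial (Fin i) F)
    (FractionRing (MvPolynomial (Fin i) F))
  have hφ : Function.Injective φ :=
    IsFractionRing.injective (MvPolynomial (Fin i) F) (FractionRing (MvPolynomial (Fin i) F))
  have : CharZero (FractionRing (MvPolynomial (Fin i) F)) :=
    charZero_of_injective_algebraMap
      (algebraMap F (FractionRing (MvPolynomial (Fin i) F))).injective
  refine linearIndependent_oddProd_of_alternants he hj (fun b => φ (MvPolynomial.X b))
    (fun b => ?_) ?_ ?_
  · rw [Ne, map_eq_zero_iff _ hφ]
    exact MvPolynomial.X_ne_zero b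
  · intro a b hab
    simp only [← map_pow] at hab
    have h1 := hφ hab
    rw [MvPolynomial.X_pow_eq_monomial, MvPolynomial.X_pow_eq_monomial,
      MvPolynomial.monomial_left_inj one_ne_zero] at h1
    exact (Finsupp.single_left_inj two_ne_zero).1 h1
  · have h1 := (linearIndependent_det_X_pow (F := F) (i := i)).map_injOn φ.toLinearMap hφ.injOn
    have h2 : ∀ α : Fin i → ℕ, φ (Matrix.of fun a b : Fin i =>
        (MvPolynomial.X b : MvPolynomial (Fin i) F) ^ (2 * α a)).det =
        (Matrix.of fun a b : Fin i => (φ (MvPolynomial.X b) ^ 2) ^ α a).det := by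
      intro α
      rw [AlgHom.map_det]
      congr 1
      apply Matrix.ext
      intro a b
      simp [pow_mul]
    simpa only [Function.comp_def, AlgHom.toLinearMap_apply, h2] using h1

end Degeneration

/-! ### Proper products span -/

theorem isMonoSusy_psum (F : Type*) [Field F] (n m : ℕ) :
    IsMonoSusy (MvPolynomial.psum (Fin n) F (2 * m + 1)) := by
  refine ⟨MvPolynomial.psum_isSymmetric _ _ _, fun h => ?_⟩
  obtain ⟨k, rfl⟩ : ∃ k, n = k + 2 := ⟨n - 2, by omega⟩
  refine ⟨∑ a : Fin k, MvPolynomial.X a.succ.succ ^ (2 * m + 1), ?_⟩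
  have hodd : Odd (2 * m + 1) := odd_two_mul_add_one m
  generalize 2 * m + 1 = d at hodd
  have h0 : (-Polynomial.X : Polynomial (MvPolynomial (Fin (k + 2)) F)) ^ d =
      -Polynomial.X ^ d := by
    rw [neg_pow (Polynomial.X : Polynomial (MvPolynomial (Fin (k + 2)) F)) d, hodd.neg_one_pow,
      neg_one_mul]
  rw [MvPolynomial.psum, map_sum, Fin.sum_univ_succ, Fin.sum_univ_succ, ← add_assoc]
  simp [subst, h0]

theorem psum_mem_T (F : Type*) [Field F] (n m : ℕ) :
    MvPolynomial.psum (Fin n) F (2 * m + 1) ∈ T F n :=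
  isMonoSusy_psum F n m

theorem oddProd_mem_T (F : Type*) [Field F] (n : ℕ) (s : Multiset ℕ) : oddProd F n s ∈ T F n :=
  Subalgebra.multiset_prod_mem _ fun p hp => by
    obtain ⟨m, -, rfl⟩ := Multiset.mem_map.1 hp
    exact psum_mem_T F n m

theorem totalDegree_oddProd_le (F : Type*) [Field F] (n : ℕ) (s : Multiset ℕ) :
    (oddProd F n s).totalDegree ≤ oddWeight s := by
  refine (MvPolynomial.totalDegree_multiset_prod _).trans ?_
  rw [Multiset.map_map]
  refine Multiset.sum_map_le_sum_map _ _ fun m _ => ?_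
  refine MvPolynomial.totalDegree_finsetSum_le fun a _ => ?_
  rw [MvPolynomial.totalDegree_X_pow]

theorem mem_properLE_iff {n D : ℕ} (hn : 0 < n) {s : Multiset ℕ} :
    s ∈ ProperLE n D ↔ IsProper n s ∧ oddWeight s ≤ D := by
  have : ∀ m, (n + 1) / 2 ≤ m ↔ jIdx n < m := fun m => by unfold jIdx; omega
  simp only [ProperLE, Set.mem_ofPred_eq, IsProper, iIdx, this]

/-- The independent proper products of degree at most `D` are at least as many as the dimension of
the space of elements of `T_n` of degree at most `D`, so they span it. -/
theorem mem_span_oddProd {F : Type*} [Field F] [CharZero F] {n : ℕ} (hn : 0 < n)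
    {p : MvPolynomial (Fin n) F} (hp : p ∈ T F n) :
    p ∈ Submodule.span F (Set.range fun s : {s : Multiset ℕ // IsProper n s} =>
      oddProd F n s.1) := by
  set D := p.totalDegree
  obtain ⟨hfin, hle⟩ := finiteDimensional_TLE_and_finrank_le F n D
  have := Fintype.ofFinite (ProperLE n D)
  let v : ProperLE n D → TLE F n D := fun s => ⟨oddProd F n s.1, oddProd_mem_T F n s.1,
    (MvPolynomial.mem_restrictTotalDegree _ _ _).2
      ((totalDegree_oddProd_le F n s.1).trans s.2.2)⟩
  have hv : LinearIndependent F v := by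
    refine LinearIndependent.of_comp (TLE F n D).subtype ?_
    exact (linearIndependent_oddProd F hn).comp
      (fun s : ProperLE n D => ⟨s.1, ((mem_properLE_iff hn).1 s.2).1⟩)
      fun s s' h => Subtype.ext (Subtype.mk.inj h)
  have hcard : Fintype.card (ProperLE n D) = Module.finrank F (TLE F n D) :=
    le_antisymm hv.fintype_card_le_finrank (by rwa [← Nat.card_eq_fintype_card])
  have htop := hv.span_eq_top_of_card_eq_finrank' hcard
  have hmem : (⟨p, hp, (MvPolynomial.mem_restrictTotalDegree _ _ _).2 le_rfl⟩ : TLE F n D) ∈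
      Submodule.span F (Set.range v) := htop ▸ Submodule.mem_top
  have h1 := Submodule.mem_map_of_mem (f := (TLE F n D).subtype) hmem
  rw [Submodule.map_span, ← Set.range_comp] at h1
  refine Submodule.span_mono ?_ h1
  rintro _ ⟨s, rfl⟩
  exact ⟨⟨s.1, ((mem_properLE_iff hn).1 s.2).1⟩, rfl⟩

end MonoSusy

theorem theorem1 (F : Type*) [Field F] [CharZero F] (n : ℕ) (hn : 0 < n) :
    Algebra.adjoin F (Set.range fun k : ℕ => MvPolynomial.psum (Fin n) F (2 * k + 1)) =
        MonoSusy.T F n ∧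
      ∃ b : Module.Basis {s : Multiset ℕ // MonoSusy.IsProper n s} F (MonoSusy.T F n),
        ∀ s, (b s : MvPolynomial (Fin n) F) = MonoSusy.oddProd F n s.1 := by
  constructor
  · apply le_antisymm
    · refine Algebra.adjoin_le ?_
      rintro _ ⟨k, rfl⟩
      exact MonoSusy.psum_mem_T F n k
    · intro p hp
      rw [← Subalgebra.mem_toSubmodule]
      refine Submodule.span_le.2 ?_ (MonoSusy.mem_span_oddProd hn hp)
      rintro _ ⟨s, rfl⟩
      refine Subalgebra.multiset_prod_mem _ fun q hq => ?_
      obtain ⟨m, -, rfl⟩ := Multiset.mem_map.1 hq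
      exact Algebra.subset_adjoin ⟨m, rfl⟩
  · let v : {s : Multiset ℕ // MonoSusy.IsProper n s} → MonoSusy.T F n := fun s =>
      ⟨MonoSusy.oddProd F n s.1, MonoSusy.oddProd_mem_T F n s.1⟩
    have hv : LinearIndependent F v :=
      LinearIndependent.of_comp (MonoSusy.T F n).val.toLinearMap
        (MonoSusy.linearIndependent_oddProd F hn)
    refine ⟨Module.Basis.mk hv ?_, fun s => by rw [Module.Basis.mk_apply]⟩
    rintro ⟨p, hp⟩ -
    have h1 := MonoSusy.mem_span_oddProd hn hp
    have h2 : (Set.range fun s : {s : Multiset ℕ // MonoSusy.IsProper n s} =>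
        MonoSusy.oddProd F n s.1) = (MonoSusy.T F n).val.toLinearMap '' Set.range v := by
      rw [← Set.range_comp]
      rfl
    rw [h2, ← Submodule.map_span] at h1
    obtain ⟨q, hq, hqp⟩ := h1
    have : q = ⟨p, hp⟩ := Subtype.ext hqp
    exact this ▸ hq
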